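/- Let $X$ be a nonempty compact Hausdorff space and let $f : X \to X$ be continuous. Let $\omega^* = \beta\omega \setminus \omega$ be the space of nonprincipal ultrafilters on $\omega$, and let $\sigma : \omega^* \to \omega^*$ be the shift map, which sends an ultrafilter $p$ to the ultrafilter generated by $\{A+1 : A \in p\}$. Let $\mathfrak{p}$ be the pseudo-intersection number, i.e. the least cardinality of a family $\mathcal{F}$ of subsets of $\omega$ such that every finite subfamily of $\mathcal{F}$ has infinite intersection but there is no infinite $A \subseteq \omega$ with $A \setminus F$ finite for all $F \in \mathcal{F}$. Suppose that the weight of $X$ (the least cardinality of a base for its topology) is less than $\mathfrak{p}$. Then $(X,f)$ is a quotient of $(\omega^*,\sigma)$, meaning that there is a continuous surjection $Q : \omega^* \to X$ with $Q \circ \sigma = f \circ Q$, if and only if $f$ is weakly incompressible, meaning that $f(\overline{U}) \not\subseteq U$ for every open $U \subseteq X$ with $\emptyset \neq U \neq X$. -/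

import Mathlib

open Set
open scoped Cardinal

universe u v

/-- The weight of a topological space: the least cardinality of a base for its topology. -/
noncomputable def topologicalWeight (X : Type u) [TopologicalSpace X] : Cardinal.{u} :=
  sInf {κ | ∃ B : Set (Set X), TopologicalSpace.IsTopologicalBasis B ∧ #B = κ}

/-- A family of subsets of `ℕ` has the strong finite intersection property if every finite
subfamily has infinite intersection. -/
def HasSFIP (𝓕 : Set (Set ℕ)) : Prop :=
  ∀ 𝓖 ⊆ 𝓕, 𝓖.Finite → (⋂₀ 𝓖).Infinite

/-- `A` is an infinite pseudo-intersection of `𝓕`: `A` is infinite and `A ⊆* F` (that is,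
`A \ F` is finite) for every `F ∈ 𝓕`. -/
def IsInfinitePseudoIntersection (A : Set ℕ) (𝓕 : Set (Set ℕ)) : Prop :=
  A.Infinite ∧ ∀ F ∈ 𝓕, (A \ F).Finite

/-- The pseudo-intersection number `𝔭`: the least cardinality of a family of subsets of `ℕ` that
has the strong finite intersection property but no infinite pseudo-intersection. -/
noncomputable def pseudoIntersectionNumber : Cardinal.{0} :=
  sInf {κ | ∃ 𝓕 : Set (Set ℕ), HasSFIP 𝓕 ∧
    (¬ ∃ A, IsInfinitePseudoIntersection A 𝓕) ∧ #𝓕 = κ}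

/-- The infimum defining `𝔭` is over a nonempty set: any nonprincipal ultrafilter is a family with
the strong finite intersection property and no infinite pseudo-intersection. -/
theorem pseudoIntersectionNumber_set_nonempty :
    {κ : Cardinal.{0} | ∃ 𝓕 : Set (Set ℕ), HasSFIP 𝓕 ∧
      (¬ ∃ A, IsInfinitePseudoIntersection A 𝓕) ∧ #𝓕 = κ}.Nonempty := by
  have key : ∀ s ∈ Filter.hyperfilter ℕ, s.Infinite :=
    fun s hs hfin => Filter.notMem_hyperfilter_of_finite hfin hs
  refine ⟨_, {s | s ∈ Filter.hyperfilter ℕ}, ?_, ?_, rfl⟩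
  · intro 𝓖 h𝓖 hfin
    exact key _ ((Filter.sInter_mem hfin).2 fun s hs => h𝓖 hs)
  · rintro ⟨A, hA, hAF⟩
    obtain ⟨g, hg⟩ : ∃ g : ℕ → ℕ, StrictMono g ∧ range g = A :=
      ⟨Nat.nth (· ∈ A), Nat.nth_strictMono hA, Nat.range_nth_of_infinite hA⟩
    have hsub : ∀ (h : ℕ → ℕ), StrictMono h → (∀ n, h n ∈ A) →
        ∀ T : Set ℕ, (∀ n, h n ∉ T) → T ∉ Filter.hyperfilter ℕ := by
      intro h hm hA' T hT hTm
      refine (Set.infinite_range_of_injective hm.injective).mono ?_ (hAF T hTm)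
      rintro _ ⟨n, rfl⟩
      exact ⟨hA' n, hT n⟩
    have hmem : ∀ n, g n ∈ A := fun n => hg.2 ▸ mem_range_self n
    have h1 := hsub (fun n => g (2 * n)) (hg.1.comp fun a b h => by show 2 * a < 2 * b; omega)
      (fun n => hmem _) (range fun n => g (2 * n))ᶜ (fun n => by simp)
    have h2 := hsub (fun n => g (2 * n + 1))
      (hg.1.comp fun a b h => by show 2 * a + 1 < 2 * b + 1; omega)
      (fun n => hmem _) (range fun n => g (2 * n)) (by
        rintro n ⟨m, hm⟩
        have := hg.1.injective hm
        omega)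
    exact h1 (Ultrafilter.compl_mem_iff_notMem.2 h2)

/-- `ω* = βω \ ω`, the space of nonprincipal ultrafilters on `ℕ`, with the topology inherited from
the Stone space `Ultrafilter ℕ = βω`. -/
abbrev OmegaStar : Type := {p : Ultrafilter ℕ // ∀ n : ℕ, p ≠ pure n}

theorem map_succ_nonprincipal (p : OmegaStar) (n : ℕ) :
    Ultrafilter.map (fun k : ℕ => k + 1) p.1 ≠ pure n := by
  intro h
  have h1 : ({n} : Set ℕ) ∈ Ultrafilter.map (fun k : ℕ => k + 1) p.1 := by
    rw [h]; exact rfl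
  rw [Ultrafilter.mem_map] at h1
  have hfin : ((fun k : ℕ => k + 1) ⁻¹' {n}).Finite :=
    (Set.finite_singleton n).preimage (fun a _ b _ hab => by simpa using hab)
  obtain ⟨x, -, hx⟩ := Ultrafilter.eq_pure_of_finite_mem hfin h1
  exact p.2 x hx

/-- The shift map `σ : ω* → ω*`; `σ p` is the ultrafilter generated by `{A + 1 | A ∈ p}`, i.e. the
pushforward of `p` under `k ↦ k + 1`. -/
def shiftMap (p : OmegaStar) : OmegaStar :=
  ⟨Ultrafilter.map (fun k : ℕ => k + 1) p.1, map_succ_nonprincipal p⟩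

/-- `(X, f)` is a quotient of `(Y, g)`: there is a continuous surjection `Q : Y → X` with
`Q ∘ g = f ∘ Q`. -/
def IsQuotientSystem {X : Type u} [TopologicalSpace X] (f : X → X)
    {Y : Type v} [TopologicalSpace Y] (g : Y → Y) : Prop :=
  ∃ Q : Y → X, Continuous Q ∧ Function.Surjective Q ∧ Q ∘ g = f ∘ Q

/-- `f` is weakly incompressible: no open `U` with `∅ ≠ U ≠ X` satisfies `f(closure U) ⊆ U`. -/
def WeaklyIncompressible {X : Type u} [TopologicalSpace X] (f : X → X) : Prop :=
  ∀ U : Set X, IsOpen U → U.Nonempty → U ≠ univ → ¬ f '' closure U ⊆ U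

/-!
For the forward direction, weak incompressibility passes to quotients, and `σ` has it: a clopen
set `A*` with `σ(A*) ⊆ A*` satisfies `A + 1 ⊆* A`, so that `A` is finite or cofinite.

For the converse, embed `X` by `e` into a cube `Y` of weight `< 𝔭`, which is separable because
`𝔭 ≤ 𝔠`, and let `Γ ⊆ Y × Y` be the image of the graph of `f`. It suffices to find a sequence `d`
in `Y` which clusters at every point of `e(X)` and whose consecutive pairs `(d n, d (n + 1))`
converge to `Γ`: then `Q p = p-lim d` is the quotient map. For an open neighbourhood of `Γ`, the
points reachable from `x` by a chain of steps in that neighbourhood form an open set `E` with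
`f(closure E) ⊆ E`, so by weak incompressibility every point is reachable, and the intermediate
points may be moved into a countable dense set. Hence finitely many requirements are always met by
a finite loop in a countable set. As there are fewer than `𝔭` requirements in all, some sequence of
loops eventually meets each of them, and `d` is the concatenation of that sequence.
-/

section PseudoIntersection

open Filter

theorem HasSFIP.exists_isInfinitePseudoIntersection {𝓕 : Set (Set ℕ)} (h𝓕 : HasSFIP 𝓕)
    (hcard : #𝓕 < pseudoIntersectionNumber) : ∃ A, IsInfinitePseudoIntersection A 𝓕 := by
  by_contra hno
  exact hcard.not_ge (csInf_le' ⟨𝓕, h𝓕, hno, rfl⟩)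

theorem HasSFIP.neBot_cofinite_inf_generate {𝓕 : Set (Set ℕ)} (h𝓕 : HasSFIP 𝓕) :
    (cofinite ⊓ generate 𝓕).NeBot := by
  refine inf_neBot_iff.2 fun C hC S hS => ?_
  obtain ⟨𝓖, h𝓖, hfin, hS⟩ := mem_generate_iff.1 hS
  have hinf : (⋂₀ 𝓖 \ Cᶜ).Infinite := (h𝓕 𝓖 h𝓖 hfin).sdiff (mem_cofinite.1 hC)
  obtain ⟨n, hn, hnC⟩ := hinf.nonempty
  exact ⟨n, not_not.1 hnC, hS hn⟩

theorem HasSFIP.exists_isInfinitePseudoIntersection_of_countable {𝓕 : Set (Set ℕ)}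
    (h𝓕 : HasSFIP 𝓕) (hcount : 𝓕.Countable) : ∃ A, IsInfinitePseudoIntersection A 𝓕 := by
  have := h𝓕.neBot_cofinite_inf_generate
  have : (cofinite : Filter ℕ).IsCountablyGenerated := Nat.cofinite_eq_atTop ▸ inferInstance
  have : (generate 𝓕).IsCountablyGenerated := ⟨𝓕, hcount, rfl⟩
  obtain ⟨u, hu⟩ := exists_seq_tendsto (cofinite ⊓ generate 𝓕)
  obtain ⟨hcofinite, hgenerate⟩ := tendsto_inf.1 hu
  refine ⟨range u, fun hfin => ?_, fun F hF => ?_⟩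
  · obtain ⟨n, hn⟩ := (hcofinite.eventually hfin.compl_mem_cofinite).exists
    exact hn (mem_range_self n)
  · have hfin : {n | u n ∉ F}.Finite := by
      rw [← Nat.cofinite_eq_atTop] at hgenerate
      exact hgenerate (mem_generate_of_mem hF)
    refine (hfin.image u).subset ?_
    rintro _ ⟨⟨n, rfl⟩, hn⟩
    exact mem_image_of_mem u hn

theorem aleph0_lt_pseudoIntersectionNumber : ℵ₀ < pseudoIntersectionNumber := by
  obtain ⟨𝓕, h𝓕, hno, hcard⟩ := csInf_mem pseudoIntersectionNumber_set_nonempty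
  refine lt_of_not_ge fun hle => hno (h𝓕.exists_isInfinitePseudoIntersection_of_countable ?_)
  exact Cardinal.le_aleph0_iff_set_countable.1 (hcard.trans_le hle)

theorem pseudoIntersectionNumber_le_continuum : pseudoIntersectionNumber ≤ 𝔠 := by
  obtain ⟨κ, hκ⟩ := pseudoIntersectionNumber_set_nonempty
  refine (csInf_le' hκ).trans ?_
  obtain ⟨𝓕, -, -, rfl⟩ := hκ
  exact (Cardinal.mk_set_le 𝓕).trans_eq (by rw [Cardinal.mk_set, Cardinal.mk_nat,
    Cardinal.two_power_aleph0])

theorem exists_seq_eventually_mem {ι : Type u} {α : Type v} [Countable α]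
    (hι : #ι < Cardinal.lift.{u} pseudoIntersectionNumber) (s : ι → Set α)
    (hs : ∀ F : Finset ι, (⋂ i ∈ F, s i).Nonempty) :
    ∃ u : ℕ → α, ∀ i, ∀ᶠ n in atTop, u n ∈ s i := by
  obtain ⟨a₀, -⟩ := hs ∅
  have : Nonempty α := ⟨a₀⟩
  -- The members `s i` may be finite; replacing `α` by `α × ℕ` makes the intersections infinite.
  obtain ⟨e⟩ : Nonempty (α × ℕ ≃ ℕ) := nonempty_equiv_of_countable
  let t : ι → Set ℕ := fun i => e.symm ⁻¹' (Prod.fst ⁻¹' s i)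
  have hsfip : HasSFIP (range t) := by
    intro 𝓖 h𝓖 hfin
    obtain ⟨F, rfl⟩ : ∃ F : Finset ι, t '' F = 𝓖 := by
      obtain ⟨F, -, hF, rfl⟩ := exists_subset_image_finite_and.1
        ⟨𝓖, by rwa [image_univ], hfin, rfl⟩
      exact ⟨hF.toFinset, by rw [hF.coe_toFinset]⟩
    obtain ⟨a, ha⟩ := hs F
    have hinj : Function.Injective fun n => e (a, n) :=
      e.injective.comp (Prod.mk_right_injective a)
    refine (infinite_range_of_injective hinj).mono ?_
    rintro _ ⟨n, rfl⟩ _ ⟨i, hi, rfl⟩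
    simpa only [t, mem_preimage, e.symm_apply_apply] using mem_iInter₂.1 ha i hi
  have hcard : #(range t) < pseudoIntersectionNumber :=
    Cardinal.lift_lt.{0, u}.1 (Cardinal.mk_range_le_lift.trans_lt (by rwa [Cardinal.lift_uzero]))
  obtain ⟨A, hA, hAt⟩ := hsfip.exists_isInfinitePseudoIntersection hcard
  refine ⟨fun n => (e.symm (Nat.nth (· ∈ A) n)).1, fun i => ?_⟩
  rw [← Nat.cofinite_eq_atTop]
  refine ((hAt (t i) (mem_range_self i)).preimage (Nat.nth_injective hA).injOn).subset ?_
  exact fun n hn => ⟨Nat.nth_mem_of_infinite hA n, hn⟩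

end PseudoIntersection

section Weight

open Topology TopologicalSpace

theorem exists_isTopologicalBasis_mk_eq_topologicalWeight (X : Type u) [TopologicalSpace X] :
    ∃ B : Set (Set X), IsTopologicalBasis B ∧ #B = topologicalWeight X :=
  csInf_mem (s := {κ | ∃ B : Set (Set X), IsTopologicalBasis B ∧ #B = κ})
    ⟨_, _, isTopologicalBasis_opens, rfl⟩

theorem topologicalWeight_le_mk {X : Type u} [TopologicalSpace X] {B : Set (Set X)}
    (hB : IsTopologicalBasis B) : topologicalWeight X ≤ #B :=
  csInf_le' ⟨B, hB, rfl⟩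

theorem topologicalWeight_le_of_eq_generateFrom {X : Type u} [t : TopologicalSpace X]
    {S : Set (Set X)} (hS : t = generateFrom S) : topologicalWeight X ≤ max #S ℵ₀ := by
  have hfinite : #{F : Set (Set X) | F.Finite ∧ F ⊆ S} ≤ #(Finset S) := by
    refine Cardinal.mk_le_of_surjective (f := fun F : Finset S =>
      ⟨Subtype.val '' (F : Set S), F.finite_toSet.image _, Subtype.coe_image_subset S _⟩) ?_
    rintro ⟨F, hF, hFS⟩
    refine ⟨(hF.preimage Subtype.val_injective.injOn).toFinset, Subtype.ext ?_⟩
    simpa only [Finite.coe_toFinset, Subtype.image_preimage_coe, inter_eq_right] using hFS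
  calc topologicalWeight X ≤ #((fun F => ⋂₀ F) '' {F : Set (Set X) | F.Finite ∧ F ⊆ S}) :=
        topologicalWeight_le_mk (isTopologicalBasis_of_subbasis hS)
    _ ≤ #(Finset S) := Cardinal.mk_image_le.trans hfinite
    _ ≤ max #S ℵ₀ := by
      cases finite_or_infinite S with
      | inl _ => exact le_max_of_le_right (Cardinal.lt_aleph0_of_finite _).le
      | inr _ => exact le_max_of_le_left (Cardinal.mk_finset_of_infinite S).le

theorem topologicalWeight_pi_le (ι : Type u) (Y : Type v) [TopologicalSpace Y]
    [SecondCountableTopology Y] :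
    topologicalWeight (ι → Y) ≤ max (Cardinal.lift.{v} #ι) ℵ₀ := by
  let S : ι × countableBasis Y → Set (ι → Y) := fun p => Function.eval p.1 ⁻¹' p.2
  have hS : (Pi.topologicalSpace : TopologicalSpace (ι → Y)) = generateFrom (range S) := by
    have : range S = ⋃ i, preimage (Function.eval i) '' countableBasis Y := by
      ext U
      simp [S]
    rw [this, generateFrom_iUnion]
    refine iInf_congr fun i => ?_
    rw [← induced_generateFrom_eq, ← eq_generateFrom_countableBasis Y]
  refine (topologicalWeight_le_of_eq_generateFrom hS).trans (max_le ?_ (le_max_right _ _))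
  calc #(range S) ≤ Cardinal.lift.{v} #ι * Cardinal.lift.{u} #(countableBasis Y) :=
        Cardinal.mk_range_le.trans_eq (Cardinal.mk_prod ι _)
    _ ≤ Cardinal.lift.{v} #ι * ℵ₀ := by
      gcongr
      exact Cardinal.lift_le_aleph0.2 (countable_countableBasis Y).le_aleph0
    _ ≤ max (Cardinal.lift.{v} #ι) ℵ₀ := Cardinal.mul_le_max_of_aleph0_le_right le_rfl

theorem topologicalWeight_prod_le (X Y : Type u) [TopologicalSpace X] [TopologicalSpace Y] :
    topologicalWeight (X × Y) ≤ topologicalWeight X * topologicalWeight Y := by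
  obtain ⟨B, hB, hBcard⟩ := exists_isTopologicalBasis_mk_eq_topologicalWeight X
  obtain ⟨C, hC, hCcard⟩ := exists_isTopologicalBasis_mk_eq_topologicalWeight Y
  rw [← hBcard, ← hCcard]
  exact (topologicalWeight_le_mk (hB.prod hC)).trans Cardinal.mk_image2_le

theorem separableSpace_pi_of_mk_le_continuum {ι : Type u} {Y : Type v} [TopologicalSpace Y]
    [TietzeExtension.{0, v} Y] [SecondCountableTopology Y] (hι : #ι ≤ 𝔠) :
    SeparableSpace (ι → Y) := by
  obtain ⟨j⟩ : Nonempty (ι ↪ ℝ) := by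
    rw [← Cardinal.lift_mk_le', Cardinal.mk_real, Cardinal.lift_continuum, Cardinal.lift_uzero]
    exact hι
  have hcont : Continuous fun (g : C(ℝ, Y)) i => g (j i) :=
    continuous_pi fun i => continuous_eval_const (j i)
  refine DenseRange.separableSpace (f := fun (g : C(ℝ, Y)) i => g (j i)) ?_ hcont
  refine dense_iff_inter_open.2 fun U hU ⟨y, hy⟩ => ?_
  obtain ⟨F, V, hV, hVU⟩ := isOpen_pi_iff.1 hU y hy
  let D : Set ℝ := j '' F
  have hD : D.Finite := F.finite_toSet.image j
  have : DiscreteTopology D := hD.instDiscreteTopology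
  choose i _ hi using fun d : D => d.2
  obtain ⟨g, hg⟩ := ContinuousMap.exists_restrict_eq (s := D) hD.isClosed
    ⟨fun d => y (i d), continuous_of_discreteTopology⟩
  refine ⟨_, hVU fun k hk => ?_, mem_range_self g⟩
  have hgk : g (j k) = y k := by
    have hkD : j k ∈ D := mem_image_of_mem j hk
    exact (DFunLike.congr_fun hg ⟨j k, hkD⟩).trans (congrArg y (j.injective (hi ⟨j k, hkD⟩)))
  exact hgk ▸ (hV k hk).2

theorem exists_isClosedEmbedding_pi_unitInterval (X : Type u) [TopologicalSpace X] [CompactSpace X]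
    [T2Space X] {κ : Cardinal.{u}} (hκ : ℵ₀ ≤ κ) (hw : topologicalWeight X < κ) :
    ∃ (ι : Type u) (e : X → ι → unitInterval), #ι < κ ∧ IsClosedEmbedding e := by
  obtain ⟨B, hB, hcard⟩ := exists_isTopologicalBasis_mk_eq_topologicalWeight X
  let ι := {b : B × B // Disjoint (closure b.1.1) (closure b.2.1)}
  have hurysohn (i : ι) : ∃ g : C(X, unitInterval),
      EqOn g 0 (closure i.1.1.1) ∧ EqOn g 1 (closure i.1.2.1) := by
    obtain ⟨g, hg₀, hg₁, hg⟩ :=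
      exists_continuous_zero_one_of_isClosed isClosed_closure isClosed_closure i.2
    exact ⟨⟨fun x => ⟨g x, hg x⟩, g.continuous.subtype_mk hg⟩,
      fun x hx => Subtype.ext (hg₀ hx), fun x hx => Subtype.ext (hg₁ hx)⟩
  choose g hg₀ hg₁ using hurysohn
  refine ⟨ι, fun x i => g i x, ?_, ?_⟩
  · rw [← hcard] at hw
    refine (Cardinal.mk_subtype_le _).trans_lt ?_
    rw [Cardinal.mk_prod, Cardinal.lift_id]
    exact Cardinal.mul_lt_of_lt hκ hw hw
  refine (continuous_pi fun i => (g i).continuous).isClosedEmbedding fun x y hxy => ?_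
  by_contra hne
  obtain ⟨U, hxU, hU, V, hyV, hV, hUV⟩ := exists_open_nhds_disjoint_closure hne
  obtain ⟨b, hb, hxb, hbU⟩ := hB.exists_subset_of_mem_open hxU hU
  obtain ⟨c, hc, hyc, hcV⟩ := hB.exists_subset_of_mem_open hyV hV
  let i : ι := ⟨(⟨b, hb⟩, ⟨c, hc⟩), hUV.mono (closure_mono hbU) (closure_mono hcV)⟩
  have h₀₁ : (0 : unitInterval) = 1 :=
    calc 0 = g i x := (hg₀ i (subset_closure hxb)).symm
      _ = g i y := congrFun hxy i
      _ = 1 := hg₁ i (subset_closure hyc)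
  exact zero_ne_one h₀₁

end Weight

section ShiftMap

open Filter Topology

theorem ultrafilter_eq_pure_iff_singleton_mem {α : Type u} {p : Ultrafilter α} {a : α} :
    p = pure a ↔ {a} ∈ p := by
  refine ⟨fun h => h ▸ mem_pure.2 rfl, fun h => ?_⟩
  obtain ⟨b, hb, hp⟩ := Ultrafilter.eq_pure_of_finite_mem (finite_singleton a) h
  rwa [mem_singleton_iff.1 hb] at hp

theorem ultrafilter_forall_ne_pure_iff_le_atTop {p : Ultrafilter ℕ} :
    (∀ n, p ≠ pure n) ↔ (p : Filter ℕ) ≤ atTop := by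
  rw [← Nat.cofinite_eq_atTop]
  refine ⟨fun hp => p.le_cofinite_or_eq_pure.resolve_right fun ⟨n, hn⟩ => hp n hn, ?_⟩
  rintro hp n rfl
  exact hp (finite_singleton n).compl_mem_cofinite rfl

theorem continuous_ultrafilter_map {α : Type u} {β : Type v} (m : α → β) :
    Continuous (Ultrafilter.map m) := by
  refine ultrafilterBasis_is_basis.continuous_iff.2 ?_
  rintro _ ⟨A, rfl⟩
  exact ultrafilter_isOpen_basic (m ⁻¹' A)

theorem continuous_shiftMap : Continuous shiftMap :=
  ((continuous_ultrafilter_map _).comp continuous_subtype_val).subtype_mk _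

namespace OmegaStar

instance : CompactSpace OmegaStar := by
  have hclosed : IsClosed {p : Ultrafilter ℕ | ∀ n : ℕ, p ≠ pure n} := by
    simp only [ne_eq, ultrafilter_eq_pure_iff_singleton_mem, ofPred_forall]
    exact isClosed_iInter fun n => (ultrafilter_isOpen_basic {n}).isClosed_compl
  exact isCompact_iff_compactSpace.1 hclosed.isCompact

theorem coe_le_atTop (p : OmegaStar) : (p.1 : Filter ℕ) ≤ atTop :=
  ultrafilter_forall_ne_pure_iff_le_atTop.1 p.2

theorem infinite_of_mem (p : OmegaStar) {A : Set ℕ} (hA : A ∈ p.1) : A.Infinite := by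
  refine frequently_cofinite_iff_infinite.1 ?_
  rw [Nat.cofinite_eq_atTop]
  exact (Eventually.frequently hA).filter_mono p.coe_le_atTop

theorem exists_mem_of_infinite {A : Set ℕ} (hA : A.Infinite) : ∃ p : OmegaStar, A ∈ p.1 := by
  have : NeBot (atTop ⊓ 𝓟 A) := by
    rw [← Nat.cofinite_eq_atTop]
    exact cofinite_inf_principal_neBot_iff.2 hA
  obtain ⟨p, hp⟩ := Ultrafilter.exists_le (atTop ⊓ 𝓟 A)
  exact ⟨⟨p, ultrafilter_forall_ne_pure_iff_le_atTop.2 (hp.trans inf_le_left)⟩,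
    le_principal_iff.1 (hp.trans inf_le_right)⟩

theorem isOpen_setOf_mem (A : Set ℕ) : IsOpen {p : OmegaStar | A ∈ p.1} :=
  (ultrafilter_isOpen_basic A).preimage continuous_subtype_val

theorem exists_setOf_mem_between {K V : Set OmegaStar} (hK : IsCompact K) (hV : IsOpen V)
    (hKV : K ⊆ V) : ∃ A : Set ℕ, K ⊆ {p | A ∈ p.1} ∧ {p : OmegaStar | A ∈ p.1} ⊆ V := by
  have hbasis (p : K) : ∃ A ∈ p.1.1, {q : OmegaStar | A ∈ q.1} ⊆ V := by
    obtain ⟨W, hW, rfl⟩ := isOpen_induced_iff.1 hV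
    obtain ⟨_, ⟨A, rfl⟩, hpA, hAW⟩ :=
      ultrafilterBasis_is_basis.exists_subset_of_mem_open (hKV p.2) hW
    exact ⟨A, hpA, fun q hq => hAW hq⟩
  choose A hpA hAV using hbasis
  obtain ⟨t, hKt⟩ := hK.elim_finite_subcover (fun p => {q : OmegaStar | A p ∈ q.1})
    (fun p => isOpen_setOf_mem (A p)) fun p hp => mem_iUnion.2 ⟨⟨p, hp⟩, hpA ⟨p, hp⟩⟩
  have hunion (q : OmegaStar) : (⋃ p ∈ t, A p) ∈ q.1 ↔ ∃ p ∈ t, A p ∈ q.1 :=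
    Ultrafilter.finite_biUnion_mem_iff t.finite_toSet
  refine ⟨⋃ p ∈ t, A p, fun q hq => ?_, fun q hq => ?_⟩
  · obtain ⟨p, hp, hqp⟩ := mem_iUnion₂.1 (hKt hq)
    exact (hunion q).2 ⟨p, hp, hqp⟩
  · obtain ⟨p, -, hqp⟩ := (hunion q).1 hq
    exact hAV p hqp

end OmegaStar

theorem eventually_mem_of_infinite_of_finite_sdiff {A : Set ℕ} (hA : A.Infinite)
    (hfin : (A \ {n | n + 1 ∈ A}).Finite) : ∀ᶠ n in atTop, n ∈ A := by
  obtain ⟨N, hN⟩ := hfin.bddAbove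
  obtain ⟨m, hmA, hNm⟩ := hA.exists_gt N
  refine eventually_atTop.2 ⟨m, fun n hmn => ?_⟩
  induction n, hmn using Nat.le_induction with
  | base => exact hmA
  | succ n hmn ih => exact not_not.1 fun hn => (hNm.trans_le hmn).not_ge (hN ⟨ih, hn⟩)

theorem weaklyIncompressible_shiftMap : WeaklyIncompressible shiftMap := by
  rintro V hV ⟨p, hp⟩ hne hVV
  obtain ⟨A, hVA, hAV⟩ := OmegaStar.exists_setOf_mem_between
    (isClosed_closure.isCompact.image continuous_shiftMap) hV hVV
  have hσA {q : OmegaStar} (hq : q ∈ closure V) : A ∈ (shiftMap q).1 :=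
    hVA (mem_image_of_mem shiftMap hq)
  have hsucc : (A \ {n | n + 1 ∈ A}).Finite := by
    by_contra hinf
    obtain ⟨q, hq⟩ := OmegaStar.exists_mem_of_infinite hinf
    have hσq : A ∈ (shiftMap q).1 :=
      hσA (subset_closure (hAV (mem_of_superset hq sdiff_subset)))
    obtain ⟨n, hn, hn'⟩ := q.1.nonempty_of_mem (inter_mem hq hσq)
    exact hn.2 hn'
  have hA : A.Infinite := (shiftMap p).infinite_of_mem (hσA (subset_closure hp))
  have htail : ∀ᶠ n in atTop, n ∈ A := eventually_mem_of_infinite_of_finite_sdiff hA hsucc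
  exact hne (eq_univ_of_forall fun q => hAV (q.coe_le_atTop htail))

theorem WeaklyIncompressible.of_isQuotientSystem {X : Type u} [TopologicalSpace X] {f : X → X}
    {Y : Type v} [TopologicalSpace Y] {g : Y → Y} (hg : WeaklyIncompressible g)
    (hfg : IsQuotientSystem f g) : WeaklyIncompressible f := by
  obtain ⟨Q, hQ, hsurj, hcomm⟩ := hfg
  intro U hU hne huniv hfU
  refine hg (Q ⁻¹' U) (hU.preimage hQ) (hne.preimage hsurj) (fun h => huniv ?_) ?_
  · rwa [preimage_eq_univ_iff, hsurj.range_eq, univ_subset_iff] at h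
  rintro _ ⟨y, hy, rfl⟩
  have hQg : Q (g y) = f (Q y) := congrFun hcomm y
  exact mem_preimage.2 (hQg ▸ hfU (mem_image_of_mem f (hQ.closure_preimage_subset U hy)))

end ShiftMap

section Chains

open Filter Topology

/-- `m` lists the intermediate points of a closed `r`-chain based at `a`. -/
def IsLoopAt {α : Type u} (r : α → α → Prop) (a : α) (m : List α) : Prop :=
  (a :: (m ++ [a])).IsChain r

theorem IsLoopAt.append {α : Type u} {r : α → α → Prop} {a : α} {m m' : List α}
    (hm : IsLoopAt r a m) (hm' : IsLoopAt r a m') : IsLoopAt r a (m ++ a :: m') := by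
  have := (List.isChain_split (l₁ := a :: m) (l₂ := m' ++ [a])).2 ⟨hm, hm'⟩
  simpa [IsLoopAt] using this

theorem exists_isLoopAt_forall_exists_mem {α : Type u} {r : α → α → Prop} {a : α} {κ : Type v}
    {V : κ → Set α} (G : Finset κ) (h₀ : ∃ m, IsLoopAt r a m)
    (hV : ∀ k ∈ G, ∃ m, IsLoopAt r a m ∧ ∃ y ∈ m, y ∈ V k) :
    ∃ m, IsLoopAt r a m ∧ ∀ k ∈ G, ∃ y ∈ m, y ∈ V k := by
  classical
  induction G using Finset.induction_on with
  | empty => simpa using h₀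
  | insert k G _ ih =>
    obtain ⟨m, hm, hmG⟩ := ih fun k hk => hV k (Finset.mem_insert_of_mem hk)
    obtain ⟨m', hm', y, hym', hy⟩ := hV k (Finset.mem_insert_self k G)
    refine ⟨m ++ a :: m', hm.append hm', Finset.forall_mem_insert _ _ _ |>.2 ⟨?_, fun j hj => ?_⟩⟩
    · exact ⟨y, by simp [hym'], hy⟩
    · obtain ⟨z, hzm, hz⟩ := hmG j hj
      exact ⟨z, by simp [hzm], hz⟩

variable {X : Type u} [TopologicalSpace X] {f : X → X} {Y : Type v} [TopologicalSpace Y]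
  {e : X → Y} {r : Y → Y → Prop} {α : Type*} {g : α → Y}

theorem isOpen_setOf_isChain_insert (hr : IsOpen {p : Y × Y | r p.1 p.2}) (l l' : List Y) :
    IsOpen {w | (l ++ w :: l').IsChain r} := by
  have hiff (w : Y) : (l ++ w :: l').IsChain r ↔
      (l.IsChain r ∧ ∀ y ∈ l.getLast?, r y w) ∧ (∀ y ∈ l'.head?, r w y) ∧ l'.IsChain r := by
    simp only [List.isChain_append, List.isChain_cons, List.head?_cons, Option.mem_def,
      Option.some.injEq, forall_eq']
    tauto
  have hinto (o : Option Y) : IsOpen {w | ∀ y ∈ o, r y w} := by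
    cases o with
    | none => simp
    | some y => simpa using hr.preimage (Continuous.prodMk_right y)
  have hfrom (o : Option Y) : IsOpen {w | ∀ y ∈ o, r w y} := by
    cases o with
    | none => simp
    | some y => simpa using hr.preimage (Continuous.prodMk_left y)
  simp only [hiff]
  exact (isOpen_const.and (hinto _)).and ((hfrom _).and isOpen_const)

theorem WeaklyIncompressible.exists_isChain
    (hf : WeaklyIncompressible f) (he : Continuous e) (hr : IsOpen {p : Y × Y | r p.1 p.2})
    (hrf : ∀ x, r (e x) (e (f x))) (hg : DenseRange g) (x y : X) :
    ∃ m : List α, (e x :: (m.map g ++ [e y])).IsChain r := by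
  let E : Set X := {y | ∃ m : List α, (e x :: (m.map g ++ [e y])).IsChain r}
  suffices h : E = univ from eq_univ_iff_forall.1 h y
  by_contra hE
  have hopen : IsOpen E := by
    simp only [E, ofPred_exists]
    exact isOpen_iUnion fun m =>
      (isOpen_setOf_isChain_insert hr (e x :: m.map g) []).preimage he
  have hfx : f x ∈ E := ⟨[], by simpa using hrf x⟩
  refine hf E hopen ⟨_, hfx⟩ hE ?_
  rintro _ ⟨z, hz, rfl⟩
  have hz_open : IsOpen {w | r (e w) (e (f z))} :=
    hr.preimage (by fun_prop : Continuous fun w => (e w, e (f z)))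
  obtain ⟨w, hwz, m, hm⟩ := mem_closure_iff.1 hz _ hz_open (hrf z)
  have hchain : (e x :: m.map g ++ e w :: [e (f z)]).IsChain r :=
    List.isChain_split.2 ⟨hm, List.isChain_pair.2 hwz⟩
  obtain ⟨a, ha⟩ :=
    hg.exists_mem_open (isOpen_setOf_isChain_insert hr (e x :: m.map g) [e (f z)]) ⟨_, hchain⟩
  exact ⟨m ++ [a], by simpa using ha⟩

theorem WeaklyIncompressible.exists_isLoopAt
    (hf : WeaklyIncompressible f) (he : Continuous e) (hr : IsOpen {p : Y × Y | r p.1 p.2})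
    (hrf : ∀ x, r (e x) (e (f x))) (hg : DenseRange g) {a : α} {x₀ : X} (ha : g a = e x₀)
    {V : Set Y} (hV : IsOpen V) {x : X} (hx : e x ∈ V) :
    ∃ m : List α, IsLoopAt (fun b c => r (g b) (g c)) a m ∧ ∃ b ∈ m, g b ∈ V := by
  obtain ⟨m₁, hm₁⟩ := hf.exists_isChain he hr hrf hg x₀ x
  obtain ⟨m₂, hm₂⟩ := hf.exists_isChain he hr hrf hg x x₀
  have hchain : (e x₀ :: m₁.map g ++ e x :: (m₂.map g ++ [e x₀])).IsChain r :=
    List.isChain_split.2 ⟨hm₁, hm₂⟩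
  obtain ⟨b, hb, hbV⟩ :=
    hg.exists_mem_open ((isOpen_setOf_isChain_insert hr _ _).inter hV) ⟨e x, hchain, hx⟩
  refine ⟨m₁ ++ b :: m₂, ?_, b, by simp, hbV⟩
  rw [← ha] at hb
  refine (List.isChain_map g).1 ?_
  simpa using hb

theorem WeaklyIncompressible.exists_isLoopAt_visiting
    (hf : WeaklyIncompressible f) (he : Continuous e) (hr : IsOpen {p : Y × Y | r p.1 p.2})
    (hrf : ∀ x, r (e x) (e (f x))) (hg : DenseRange g) {a : α} {x₀ : X} (ha : g a = e x₀)
    {κ : Type*} {V : κ → Set Y} (hV : ∀ k, IsOpen (V k)) (hVe : ∀ k, ∃ x, e x ∈ V k)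
    (G : Finset κ) :
    ∃ m : List α, IsLoopAt (fun b c => r (g b) (g c)) a m ∧ ∀ k ∈ G, ∃ b ∈ m, g b ∈ V k := by
  refine exists_isLoopAt_forall_exists_mem (V := fun k => g ⁻¹' V k) G ?_ fun k _ => ?_
  · obtain ⟨m, hm, -⟩ := hf.exists_isLoopAt he hr hrf hg ha isOpen_univ (mem_univ (e x₀))
    exact ⟨m, hm⟩
  · obtain ⟨x, hx⟩ := hVe k
    exact hf.exists_isLoopAt he hr hrf hg ha (hV k) hx

end Chains

section Concatenation

open Filter

theorem exists_seq_of_isPrefix {α : Type u} {L : ℕ → List α} (hL : ∀ n, L n <+: L (n + 1))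
    (hlen : ∀ n, n ≤ (L n).length) :
    ∃ d : ℕ → α, ∀ n k, k < (L n).length → (L n)[k]? = some (d k) := by
  have hmono {m n : ℕ} (hmn : m ≤ n) : L m <+: L n := by
    induction n, hmn using Nat.le_induction with
    | base => exact List.prefix_rfl
    | succ n _ ih => exact ih.trans (hL n)
  refine ⟨fun k => (L (k + 1))[k]'(hlen (k + 1)), fun n k hk => ?_⟩
  rw [List.getElem?_eq_getElem hk]
  congr 1
  rcases le_total n (k + 1) with h | h
  · exact (hmono h).getElem hk
  · exact ((hmono h).getElem _).symm

/-- The concatenation `a :: l 0 ++ a :: l 1 ++ ⋯ ++ a :: l (n - 1)` of the first `n` of the loops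
`l` at `a`. -/
def loopPrefix {α : Type u} (a : α) (l : ℕ → List α) : ℕ → List α
  | 0 => []
  | n + 1 => loopPrefix a l n ++ a :: l n

variable {α : Type u} {a : α} {l : ℕ → List α}

theorem le_length_loopPrefix (a : α) (l : ℕ → List α) (n : ℕ) : n ≤ (loopPrefix a l n).length := by
  induction n with
  | zero => exact Nat.zero_le _
  | succ n ih =>
    rw [loopPrefix, List.length_append, List.length_cons]
    omega

theorem exists_loopPrefix_eq_append_isChain {r : α → α → Prop} {N : ℕ}
    (hl : ∀ n ≥ N, IsLoopAt r a (l n)) {n : ℕ} (hn : N ≤ n) :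
    ∃ s, loopPrefix a l n = loopPrefix a l N ++ s ∧ (s ++ [a]).IsChain r := by
  induction n, hn using Nat.le_induction with
  | base => exact ⟨[], by simp⟩
  | succ n hn ih =>
    obtain ⟨s, hs, hchain⟩ := ih
    refine ⟨s ++ a :: l n, by rw [loopPrefix, hs, List.append_assoc], ?_⟩
    rw [List.append_assoc]
    exact List.isChain_split.2 ⟨hchain, hl n hn⟩

theorem exists_seq_concat_isLoopAt (a : α) (l : ℕ → List α) :
    ∃ d : ℕ → α,
      (∀ r, (∀ᶠ n in atTop, IsLoopAt r a (l n)) → ∀ᶠ k in atTop, r (d k) (d (k + 1))) ∧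
      ∀ V : Set α, (∃ᶠ n in atTop, ∃ y ∈ l n, y ∈ V) → ∃ᶠ k in atTop, d k ∈ V := by
  obtain ⟨d, hd⟩ := exists_seq_of_isPrefix
    (fun n => List.prefix_append (loopPrefix a l n) (a :: l n)) (le_length_loopPrefix a l)
  refine ⟨d, fun r hr => ?_, fun V hV => ?_⟩
  · obtain ⟨N, hN⟩ := eventually_atTop.1 hr
    refine eventually_atTop.2 ⟨max N (loopPrefix a l N).length, fun k hk => ?_⟩
    obtain ⟨hNk, hlen⟩ := max_le_iff.1 hk
    obtain ⟨s, hs, hchain⟩ := exists_loopPrefix_eq_append_isChain hN (le_add_right hNk : N ≤ k + 2)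
    have hk₂ : k + 2 ≤ (loopPrefix a l (k + 2)).length := le_length_loopPrefix a l (k + 2)
    have hdk := hd (k + 2) k (by omega)
    have hdk' := hd (k + 2) (k + 1) (by omega)
    rw [hs, List.getElem?_append_right (by omega)] at hdk hdk'
    obtain ⟨_, hsk⟩ := List.getElem?_eq_some_iff.1 hdk
    rw [Nat.sub_add_comm hlen] at hdk'
    obtain ⟨hlt, hsk'⟩ := List.getElem?_eq_some_iff.1 hdk'
    rw [← hsk, ← hsk']
    exact List.isChain_iff_getElem.1 hchain.left_of_append _ hlt
  · refine frequently_atTop.2 fun K => ?_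
    obtain ⟨n, hKn, y, hy, hyV⟩ := frequently_atTop.1 hV K
    obtain ⟨i, hi, rfl⟩ := List.getElem_of_mem (List.mem_cons_of_mem a hy)
    have hdi := hd (n + 1) ((loopPrefix a l n).length + i) (by
      rw [loopPrefix, List.length_append]; omega)
    refine ⟨(loopPrefix a l n).length + i, ?_, ?_⟩
    · exact hKn.trans ((le_length_loopPrefix a l n).trans (Nat.le_add_right _ _))
    · rw [loopPrefix, List.getElem?_append_right (Nat.le_add_right _ _), Nat.add_sub_cancel_left,
        List.getElem?_eq_getElem hi, Option.some.injEq] at hdi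
      rwa [← hdi]

theorem exists_seq_of_isLoopAt {α : Type v} [Countable α] (a : α) {J K : Type u}
    (hJ : #J < Cardinal.lift.{u} pseudoIntersectionNumber)
    (hK : #K < Cardinal.lift.{u} pseudoIntersectionNumber)
    (r : J → α → α → Prop) (V : K → Set α)
    (hloop : ∀ (F : Finset J) (G : Finset K),
      ∃ m, (∀ j ∈ F, IsLoopAt (r j) a m) ∧ ∀ k ∈ G, ∃ y ∈ m, y ∈ V k) :
    ∃ d : ℕ → α, (∀ j, ∀ᶠ n in atTop, r j (d n) (d (n + 1))) ∧ ∀ k, ∃ᶠ n in atTop, d n ∈ V k := by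
  have hJK : #(J ⊕ K) < Cardinal.lift.{u} pseudoIntersectionNumber := by
    rw [Cardinal.mk_sum, Cardinal.lift_id, Cardinal.lift_id]
    exact Cardinal.add_lt_of_lt
      (Cardinal.aleph0_le_lift.2 aleph0_lt_pseudoIntersectionNumber.le) hJ hK
  let s : J ⊕ K → Set (List α) :=
    Sum.elim (fun j => {m | IsLoopAt (r j) a m}) fun k => {m | ∃ y ∈ m, y ∈ V k}
  obtain ⟨l, hl⟩ := exists_seq_eventually_mem hJK s fun H => by
    obtain ⟨m, hmJ, hmK⟩ := hloop H.toLeft H.toRight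
    refine ⟨m, mem_iInter₂.2 ?_⟩
    rintro (j | k) hH
    · exact hmJ j (Finset.mem_toLeft.2 hH)
    · exact hmK k (Finset.mem_toRight.2 hH)
  obtain ⟨d, hdr, hdV⟩ := exists_seq_concat_isLoopAt a l
  exact ⟨d, fun j => hdr _ (hl (.inl j)), fun k => hdV _ (hl (.inr k)).frequently⟩

end Concatenation

section Construction

open Filter Topology TopologicalSpace

theorem tendsto_nhdsSet_of_eventually_notMem_closure {Z : Type u} [TopologicalSpace Z]
    [CompactSpace Z] [RegularSpace Z] {B : Set (Set Z)} (hB : IsTopologicalBasis B) {Γ : Set Z}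
    (hΓ : IsClosed Γ) {α : Type v} {l : Filter α} {u : α → Z}
    (hu : ∀ b ∈ B, Disjoint (closure b) Γ → ∀ᶠ n in l, u n ∉ closure b) :
    Tendsto u l (𝓝ˢ Γ) := by
  refine isCompact_univ.tendsto_nhdsSet_of_mapClusterPt (Eventually.of_forall fun _ => mem_univ _)
    fun z _ hz => by_contra fun hzΓ => ?_
  obtain ⟨b, hb, hzb, hbΓ⟩ := hB.exists_closure_subset (hΓ.isOpen_compl.mem_nhds hzΓ)
  have hfreq : ∃ᶠ n in l, u n ∈ b := hz.frequently ((hB.isOpen hb).mem_nhds hzb)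
  obtain ⟨n, hn, hn'⟩ := (hfreq.and_eventually (hu b hb (disjoint_left.2 hbΓ))).exists
  exact hn' (subset_closure hn)

theorem WeaklyIncompressible.exists_seq_tendsto_nhdsSet_graph {X : Type v} [TopologicalSpace X]
    [CompactSpace X] [Nonempty X] {f : X → X} (hwi : WeaklyIncompressible f) (hf : Continuous f)
    {Y : Type u} [TopologicalSpace Y] [CompactSpace Y] [T2Space Y] [SeparableSpace Y]
    (hY : topologicalWeight Y < Cardinal.lift.{u} pseudoIntersectionNumber)
    {e : X → Y} (he : Continuous e) :
    ∃ d : ℕ → Y, Tendsto (fun n => (d n, d (n + 1))) atTop (𝓝ˢ (range fun x => (e x, e (f x)))) ∧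
      ∀ x, MapClusterPt (e x) atTop d := by
  obtain ⟨x₀⟩ := ‹Nonempty X›
  obtain ⟨D, hDc, hD⟩ := exists_countable_dense Y
  let α := ↥(insert (e x₀) D)
  have : Countable α := (hDc.insert (e x₀)).to_subtype
  let a : α := ⟨e x₀, mem_insert _ _⟩
  have hdense : DenseRange ((↑) : α → Y) := by
    simpa only [DenseRange, Subtype.range_coe] using hD.mono (subset_insert (e x₀) D)
  obtain ⟨B, hB, hBcard⟩ := exists_isTopologicalBasis_mk_eq_topologicalWeight Y
  obtain ⟨B₂, hB₂, hB₂card⟩ := exists_isTopologicalBasis_mk_eq_topologicalWeight (Y × Y)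
  have hYY : topologicalWeight (Y × Y) < Cardinal.lift.{u} pseudoIntersectionNumber :=
    (topologicalWeight_prod_le Y Y).trans_lt (Cardinal.mul_lt_of_lt
      (Cardinal.aleph0_le_lift.2 aleph0_lt_pseudoIntersectionNumber.le) hY hY)
  set Γ : Set (Y × Y) := range fun x => (e x, e (f x))
  have hΓ : IsClosed Γ := (isCompact_range (by fun_prop)).isClosed
  let J := {b : B₂ // Disjoint (closure b.1) Γ}
  let K := {b : B // ∃ x, e x ∈ b.1}
  let r : J → α → α → Prop := fun j b c => ((b : Y), (c : Y)) ∉ closure j.1.1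
  let V : K → Set α := fun k => (↑) ⁻¹' k.1.1
  have hloop (F : Finset J) (G : Finset K) :
      ∃ m, (∀ j ∈ F, IsLoopAt (r j) a m) ∧ ∀ k ∈ G, ∃ b ∈ m, b ∈ V k := by
    let R : Y → Y → Prop := fun y z => ∀ j ∈ F, (y, z) ∉ closure j.1.1
    have hR : IsOpen {p : Y × Y | R p.1 p.2} := by
      simp only [R, ofPred_forall]
      exact isOpen_biInter_finset fun j _ => isClosed_closure.isOpen_compl
    have hRf (x : X) : R (e x) (e (f x)) :=
      fun j _ hx => disjoint_left.1 j.2 hx (mem_range_self x)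
    obtain ⟨m, hm, hmG⟩ := hwi.exists_isLoopAt_visiting he hR hRf hdense (a := a) rfl
      (fun k : K => hB.isOpen k.1.2) (fun k => k.2) G
    exact ⟨m, fun j hj => hm.imp fun _ _ h => h j hj, hmG⟩
  obtain ⟨d, hdr, hdV⟩ := exists_seq_of_isLoopAt a
    ((Cardinal.mk_subtype_le _).trans_lt (hB₂card.trans_lt hYY))
    ((Cardinal.mk_subtype_le _).trans_lt (hBcard.trans_lt hY)) r V hloop
  refine ⟨fun n => d n, ?_, fun x => ?_⟩
  · exact tendsto_nhdsSet_of_eventually_notMem_closure hB₂ hΓ fun b hb hbΓ => hdr ⟨⟨b, hb⟩, hbΓ⟩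
  · exact hB.nhds_hasBasis.mapClusterPt_iff_frequently.2 fun b hb => hdV ⟨⟨b, hb.1⟩, x, hb.2⟩

theorem exists_le_nhds_of_le_nhdsSet {Z : Type u} [TopologicalSpace Z] {S : Set Z}
    (hS : IsCompact S) {p : Ultrafilter Z} (hp : (p : Filter Z) ≤ 𝓝ˢ S) :
    ∃ z ∈ S, (p : Filter Z) ≤ 𝓝 z := by
  by_contra! hno
  have hdisj : Disjoint (𝓝ˢ S) p :=
    hS.disjoint_nhdsSet_left.2 fun z hz => (Ultrafilter.disjoint_iff_not_le.2 (hno z hz)).symm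
  exact Ultrafilter.disjoint_iff_not_le.1 hdisj.symm hp

theorem isQuotientSystem_of_tendsto_nhdsSet_graph {X : Type u} [TopologicalSpace X]
    [CompactSpace X] {f : X → X} (hf : Continuous f)
    {Y : Type v} [TopologicalSpace Y] [CompactSpace Y] [T2Space Y] {e : X → Y} (he : IsEmbedding e)
    {d : ℕ → Y}
    (hd : Tendsto (fun n => (d n, d (n + 1))) atTop (𝓝ˢ (range fun x => (e x, e (f x)))))
    (hcluster : ∀ x, MapClusterPt (e x) atTop d) : IsQuotientSystem f shiftMap := by
  have hlimit (p : OmegaStar) : ∃ x, Tendsto d p.1 (𝓝 (e x)) ∧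
      Tendsto d (shiftMap p).1 (𝓝 (e (f x))) := by
    have hle : (p.1.map fun n => (d n, d (n + 1)) : Filter (Y × Y)) ≤
        𝓝ˢ (range fun x => (e x, e (f x))) := hd.mono_left p.coe_le_atTop
    have hcompact : IsCompact (range fun x => (e x, e (f x))) :=
      isCompact_range (he.continuous.prodMk (he.continuous.comp hf))
    obtain ⟨_, ⟨x, rfl⟩, hx⟩ := exists_le_nhds_of_le_nhdsSet hcompact hle
    rw [nhds_prod_eq] at hx
    exact ⟨x, tendsto_prod_iff'.1 hx⟩
  choose Q hQ hQσ using hlimit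
  have hextend (p : OmegaStar) : Ultrafilter.extend d p.1 = e (Q p) :=
    ultrafilter_extend_eq_iff.2 (hQ p)
  refine ⟨Q, ?_, fun x => ?_, funext fun p => he.injective ?_⟩
  · rw [he.continuous_iff]
    exact ((continuous_ultrafilter_extend d).comp continuous_subtype_val).congr hextend
  · obtain ⟨p, hp, hpx⟩ := mapClusterPt_iff_ultrafilter.1 (hcluster x)
    let q : OmegaStar := ⟨p, ultrafilter_forall_ne_pure_iff_le_atTop.2 hp⟩
    exact ⟨q, he.injective (tendsto_nhds_unique (hQ q) hpx)⟩
  · exact tendsto_nhds_unique (hQ (shiftMap p)) (hQσ p)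

end Construction

theorem mainTheorem2 {X : Type u} [TopologicalSpace X] [CompactSpace X] [T2Space X] [Nonempty X]
    (f : X → X) (hf : Continuous f)
    (hw : topologicalWeight X < Cardinal.lift.{u} pseudoIntersectionNumber) :
    IsQuotientSystem f shiftMap ↔ WeaklyIncompressible f := by
  refine ⟨weaklyIncompressible_shiftMap.of_isQuotientSystem, fun hwi => ?_⟩
  have hκ : ℵ₀ < Cardinal.lift.{u} pseudoIntersectionNumber :=
    Cardinal.aleph0_lt_lift.2 aleph0_lt_pseudoIntersectionNumber
  obtain ⟨ι, e, hι, he⟩ := exists_isClosedEmbedding_pi_unitInterval X hκ.le hw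
  have : TopologicalSpace.SeparableSpace (ι → unitInterval) := by
    refine separableSpace_pi_of_mk_le_continuum (hι.le.trans ?_)
    simpa using Cardinal.lift_le.{u}.2 pseudoIntersectionNumber_le_continuum
  have hweight : topologicalWeight (ι → unitInterval) <
      Cardinal.lift.{u} pseudoIntersectionNumber := by
    refine (topologicalWeight_pi_le ι unitInterval).trans_lt (max_lt ?_ hκ)
    rwa [Cardinal.lift_uzero]
  obtain ⟨d, hd, hcluster⟩ := hwi.exists_seq_tendsto_nhdsSet_graph hf hweight he.continuous
  exact isQuotientSystem_of_tendsto_nhdsSet_graph hf he.isEmbedding hd hcluster
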